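/- All graphs are finite, undirected and simple. An antimagic labeling of a graph $G$ is a bijection $\phi : E(G)\to\{1,2,\dots,|E(G)|\}$ such that the vertex sums $s(v)=\sum_{e\ni v}\phi(e)$, $v\in V(G)$, are pairwise distinct; $G$ is called antimagic if it has an antimagic labeling. For a tree $T$, let $V_{even}(T)$ denote the set of vertices of $T$ of even degree. Theorem. Let $T$ be a tree that is not isomorphic to $K_2$. If $V_{even}(T)$ induces a path in $T$ and $|V_{even}(T)|$ is even (the case $V_{even}(T)=\emptyset$ being included, as the path on no vertices), then $T$ is antimagic. -/

import Mathlib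

namespace SimpleGraph

variable {V : Type*}

/-- The vertex sum at `v`: the sum of the labels of the edges of `G` incident to `v`. Only the
values of `φ` on edges of `G` matter. -/
def vertexSum (G : SimpleGraph V) [Fintype V] [DecidableEq V] [DecidableRel G.Adj]
    (φ : Sym2 V → ℕ) (v : V) : ℕ :=
  ∑ e ∈ G.incidenceFinset v, φ e

/-- `φ` restricts to a bijection from the edge set of `G` onto `{1, …, |E(G)|}`, and distinct
vertices have distinct vertex sums. -/
def IsAntimagicLabeling (G : SimpleGraph V) [Fintype V] [DecidableEq V] [DecidableRel G.Adj]
    (φ : Sym2 V → ℕ) : Prop :=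
  Set.BijOn φ G.edgeSet (Set.Icc 1 G.edgeFinset.card) ∧ Function.Injective (G.vertexSum φ)

/-- `G` has an antimagic labeling. -/
def IsAntimagic (G : SimpleGraph V) [Fintype V] [DecidableEq V] [DecidableRel G.Adj] : Prop :=
  ∃ φ : Sym2 V → ℕ, G.IsAntimagicLabeling φ

/-- The set of vertices of even degree. -/
def evenDegreeVertices (G : SimpleGraph V) [Fintype V] [DecidableRel G.Adj] : Set V :=
  {v | Even (G.degree v)}

/-- The subgraph of `G` induced by `S` is a path. The path on `n = 0` vertices is allowed, so the
empty set induces a path. -/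
def InducesPath (G : SimpleGraph V) (S : Set V) : Prop :=
  ∃ n : ℕ, Nonempty (G.induce S ≃g pathGraph n)

end SimpleGraph

/-! Extend the even path by an odd vertex at each end to a path `v 0, …, v N`, and root the tree at
`v 0`. By parity every vertex has an even number of children off the path, so the `2t` edges off the
path can be labeled by `s+1, …, s+2t` with sibling edges paired to the sum `M = 2s+2t+1`. Modulo
`M`, an off-path vertex then sees only the label of its parent edge, and a path vertex only its path
edges.

The remaining labels, reduced modulo `M`, are small signed integers. `exists_signed_path_labeling`
places them along the path so that the sums at path vertices are distinct and lie in `[-s, s]`,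
while off-path residues are distinct and lie in `[s+1, s+2t]`. Together these are `M` consecutive
integers, so residues separate all vertices. Without even vertices the path is a single pendant edge
labeled `M`; its two ends share residue `0` and are separated by size. -/

/-! ### Labelings of paths and of even fibers -/

/-- A signed labeling of the edges of a path with `2 * k + 1` edges whose vertex sums are distinct
and do not exceed the largest label in absolute value. -/
theorem exists_signed_path_labeling {k : ℕ} (hk : 0 < k) :
    ∃ (s : ℕ) (ε : ℕ → ℤ), k < s ∧ s ≤ 2 * k ∧ ε 0 = 0 ∧ ε (2 * k + 2) = 0 ∧
      Set.InjOn ε (Set.Icc 1 (2 * k + 1)) ∧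
      (∀ i, 1 ≤ i → i ≤ 2 * k + 1 →
        (1 ≤ ε i ∧ ε i ≤ s) ∨ (-(s : ℤ) ≤ ε i ∧ ε i ≤ 2 * k - 2 * s)) ∧
      Set.InjOn (fun i ↦ ε i + ε (i + 1)) (Set.Iic (2 * k + 1)) ∧
      ∀ i, i ≤ 2 * k + 1 → -(s : ℤ) ≤ ε i + ε (i + 1) ∧ ε i + ε (i + 1) ≤ s := by
  rcases Nat.even_or_odd' k with ⟨q, rfl | rfl⟩
  -- Two interleaved progressions make adjacent sums move in unit steps, upward in the first half
  -- and downward in the second. The sums fill `{-3q} ∪ [-q, 3q]`.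
  · let ε : ℕ → ℤ := fun i ↦
      if i = 0 ∨ 4 * q + 2 ≤ i then 0
      else if i ≤ 2 * q + 1 then
        if i % 2 = 1 then (i / 2 : ℕ) - 3 * q else 2 * q + (i / 2 : ℕ)
      else if i % 2 = 0 then 2 * q + 1 - (i / 2 : ℕ) else 3 * q + 1 - (i / 2 : ℕ)
    have hσ : ∀ i, i ≤ 4 * q + 1 → ε i + ε (i + 1) =
        if i = 0 then -3 * (q : ℤ) else if i ≤ 2 * q then i - q
        else if i = 2 * q + 1 then -(q : ℤ) else 5 * q + 2 - i := by
      intro i hi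
      simp only [ε, Nat.add_eq_zero_iff, one_ne_zero, and_false, false_or]
      split_ifs <;> omega
    refine ⟨3 * q, ε, by omega, by omega, ?_, ?_, ?_, ?_, ?_, ?_⟩
    · simp [ε]
    · simp only [ε]; split_ifs <;> omega
    · rintro i ⟨hi, hi'⟩ j ⟨hj, hj'⟩ h
      simp only [ε] at h
      split_ifs at h <;> omega
    · intro i hi hi'
      simp only [ε]
      split_ifs <;> omega
    · intro i hi j hj h
      simp only [Set.mem_Iic] at hi hj
      simp only [hσ i (by omega), hσ j (by omega)] at h
      split_ifs at h <;> omega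
    · intro i hi
      rw [hσ i (by omega)]
      split_ifs <;> omega
  -- Signs alternate except at `2q+3, 2q+4`, both positive: this replaces the sum `-2` by `2q+1`,
  -- and the sums fill `[-2q-2, 2q+2]` without `-2`.
  · let ε : ℕ → ℤ := fun i ↦
      if i = 0 ∨ 4 * q + 4 ≤ i then 0
      else if i ≤ 2 * q + 2 then
        if i % 2 = 1 then 2 * q + 2 - (i / 2 : ℕ) else -(i / 2 : ℕ) - 1
      else if i = 2 * q + 3 then q + 1
      else if i % 2 = 0 then 2 * q + 2 - (i / 2 : ℕ) else -(i / 2 : ℕ) - 1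
    have hσ : ∀ i, i ≤ 4 * q + 3 → ε i + ε (i + 1) =
        if i = 0 then 2 * (q : ℤ) + 2 else if i = 2 * q + 3 then 2 * (q : ℤ) + 1
        else 2 * q + 1 - i := by
      intro i hi
      simp only [ε, Nat.add_eq_zero_iff, one_ne_zero, and_false, false_or]
      split_ifs <;> omega
    refine ⟨2 * q + 2, ε, by omega, by omega, ?_, ?_, ?_, ?_, ?_, ?_⟩
    · simp [ε]
    · simp only [ε]; split_ifs <;> omega
    · rintro i ⟨hi, hi'⟩ j ⟨hj, hj'⟩ h
      simp only [ε] at h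
      split_ifs at h <;> omega
    · intro i hi hi'
      simp only [ε]
      split_ifs <;> omega
    · intro i hi j hj h
      simp only [Set.mem_Iic] at hi hj
      simp only [hσ i (by omega), hσ j (by omega)] at h
      split_ifs at h <;> omega
    · intro i hi
      rw [hσ i (by omega)]
      split_ifs <;> omega

/-- If all fibers of `p` on `O` have even size, then `O` can be labeled by an interval so that each
fiber splits into pairs of the same sum. -/
theorem exists_labeling_of_even_fibers {V : Type*} [DecidableEq V] (p : V → V) (t : ℕ) :
    ∀ (O : Finset V) (s : ℕ), O.card = 2 * t → (∀ x, Even (O.filter (p · = x)).card) →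
      ∃ f : V → ℕ, Set.InjOn f O ∧ (∀ y ∈ O, s + 1 ≤ f y ∧ f y ≤ s + 2 * t) ∧
        ∀ x, ∑ y ∈ O.filter (p · = x), f y =
          (2 * s + 2 * t + 1) * ((O.filter (p · = x)).card / 2) := by
  induction t with
  | zero =>
    intro O s hO _
    obtain rfl : O = ∅ := by simpa using hO
    exact ⟨0, by simp⟩
  | succ t ih =>
    intro O s hO hfib
    obtain ⟨a, ha⟩ : O.Nonempty := Finset.card_pos.mp (by omega)
    have hcard : 1 < (O.filter (p · = p a)).card := by
      have h₁ : 0 < (O.filter (p · = p a)).card := Finset.card_pos.mpr ⟨a, by simp [ha]⟩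
      obtain ⟨c, hc⟩ := hfib (p a)
      omega
    obtain ⟨b, hb, hba⟩ := Finset.exists_mem_ne hcard a
    simp only [Finset.mem_filter] at hb
    obtain ⟨hb, hpb⟩ := hb
    set O' := (O.erase a).erase b with hO'
    have hbO : b ∈ O.erase a := by simp [hba, hb]
    have hfilter : ∀ x, O'.filter (p · = x) = ((O.filter (p · = x)).erase a).erase b := by
      intro x
      ext y
      simp only [hO', Finset.mem_filter, Finset.mem_erase]
      tauto
    have hcard' : ∀ x, (O.filter (p · = x)).card =
        (O'.filter (p · = x)).card + if p a = x then 2 else 0 := by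
      intro x
      rw [hfilter]
      split_ifs with h
      · have h₁ : a ∈ O.filter (p · = x) := by simp [ha, h]
        have h₂ : b ∈ (O.filter (p · = x)).erase a := by simp [hb, hpb, h, hba]
        rw [← Finset.card_erase_add_one h₁, ← Finset.card_erase_add_one h₂]
      · rw [Finset.erase_eq_of_notMem (s := O.filter (p · = x)) (by simp [h]),
          Finset.erase_eq_of_notMem (by simp [hpb, h])]
        rfl
    obtain ⟨f, hinj, hrange, hsum⟩ := ih O' (s + 1)
      (by rw [hO', Finset.card_erase_of_mem hbO, Finset.card_erase_of_mem ha]; omega)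
      (fun x ↦ by
        have h₁ := hfib x
        rw [hcard' x] at h₁
        split_ifs at h₁
        · exact (Nat.even_add.mp h₁).mpr even_two
        · simpa using h₁)
    -- Two elements of one fiber take the extreme labels. Their sum `2s+2(t+1)+1` is also the pair
    -- sum of the inner interval, given by `s+1` and `t`.
    let g : V → ℕ := fun y ↦ if y = a then s + 1 else if y = b then s + 2 * (t + 1) else f y
    have hg : ∀ y ∈ O', g y = f y := by
      intro y hy
      simp only [hO', Finset.mem_erase] at hy
      simp [g, hy]
    have hga : g a = s + 1 := by simp [g]
    have hgb : g b = s + 2 * (t + 1) := by simp [g, hba]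
    have hmem : ∀ y ∈ O, y = a ∨ y = b ∨ y ∈ O' := by
      intro y hy
      simp only [hO', Finset.mem_erase]
      tauto
    refine ⟨g, ?_, ?_, ?_⟩
    · intro y hy z hz h
      rcases hmem y hy with rfl | rfl | hy' <;> rcases hmem z hz with rfl | rfl | hz'
      all_goals first
        | rfl
        | (exfalso; omega)
        | (have := hrange _ hz'; rw [hg _ hz'] at h; exfalso; omega)
        | (have := hrange _ hy'; rw [hg _ hy'] at h; exfalso; omega)
        | (rw [hg _ hz', hg _ hy'] at h; exact hinj hy' hz' h)
    · intro y hy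
      rcases hmem y hy with rfl | rfl | hy'
      · omega
      · omega
      · have := hrange _ hy'
        rw [hg _ hy']
        omega
    · intro x
      have hsum' : ∑ y ∈ O'.filter (p · = x), g y = ∑ y ∈ O'.filter (p · = x), f y :=
        Finset.sum_congr rfl fun y hy ↦ hg y (Finset.mem_of_mem_filter y hy)
      rw [hcard' x]
      split_ifs with h
      · have h₁ : a ∈ O.filter (p · = x) := by simp [ha, h]
        have h₂ : b ∈ (O.filter (p · = x)).erase a := by simp [hb, hpb, h, hba]
        rw [← Finset.sum_erase_add _ _ h₁, ← Finset.sum_erase_add _ _ h₂, ← hfilter, hsum', hsum,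
          hga, hgb, Nat.add_div_right _ two_pos]
        ring
      · have h₁ : (O.filter (p · = x)) = O'.filter (p · = x) := by
          rw [hfilter, Finset.erase_eq_of_notMem (s := O.filter (p · = x)) (by simp [h]),
            Finset.erase_eq_of_notMem (by simp [hpb, h])]
        rw [h₁, hsum', hsum, add_zero]
        congr 1
        ring

namespace SimpleGraph

section Tree

variable {V : Type*} [Fintype V] [DecidableEq V] {G : SimpleGraph V} [DecidableRel G.Adj]

/-! ### Rooted trees -/

/-- A rooted tree has a parent function, and every edge joins a vertex other than the root to its
parent. -/
theorem IsTree.exists_parent (hG : G.IsTree) (r : V) : ∃ p : V → V, p r = r ∧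
    (∀ x, x ≠ r → G.Adj x (p x) ∧ G.dist r x = G.dist r (p x) + 1) ∧
    Set.InjOn (fun x ↦ s(x, p x)) {r}ᶜ ∧
    (Finset.univ.erase r).image (fun x ↦ s(x, p x)) = G.edgeFinset := by
  have h : ∀ x, ∃ y, (x = r → y = r) ∧ (x ≠ r → G.Adj x y ∧ G.dist r x = G.dist r y + 1) := by
    intro x
    by_cases hx : x = r
    · exact ⟨r, by simp [hx]⟩
    obtain ⟨w, hw⟩ := hG.connected.exists_walk_length_eq_dist x r
    cases w with
    | nil => exact absurd rfl hx
    | @cons _ y _ hxy w =>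
      refine ⟨y, by simp [hx], fun _ ↦ ⟨hxy, ?_⟩⟩
      have h₁ := dist_le w
      have h₂ := hG.dist_eq_dist_add_one_of_adj r hxy
      rw [Walk.length_cons] at hw
      rw [dist_comm (u := r), dist_comm (u := r)] at *
      omega
  choose p hp hp' using h
  have hinj : Set.InjOn (fun x ↦ s(x, p x)) {r}ᶜ := by
    intro x hx y hy hxy
    rcases Sym2.eq_iff.mp hxy with h | ⟨h₁, h₂⟩
    · exact h.1
    · have h₃ := (hp' x hx).2
      have h₄ := (hp' y hy).2
      rw [h₂] at h₃
      rw [← h₁] at h₄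
      omega
  refine ⟨p, hp r rfl, hp', hinj, Finset.eq_of_subset_of_card_le ?_ ?_⟩
  · intro e he
    obtain ⟨x, hx, rfl⟩ := Finset.mem_image.mp he
    simpa using (hp' x (Finset.ne_of_mem_erase hx)).1
  -- Parent edges are distinct and number `|V| - 1`, as many as the tree has edges.
  · rw [Finset.card_image_of_injOn (hinj.mono fun x hx ↦ by simpa using hx),
      Finset.card_erase_of_mem (Finset.mem_univ r), Finset.card_univ, ← hG.card_edgeFinset]
    simp

/-- The edges at `x` in a rooted tree lead to its children and, if `x` is not the root, to its
parent. -/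
theorem incidenceFinset_eq_image_parent {r : V} {p : V → V}
    (himage : (Finset.univ.erase r).image (fun x ↦ s(x, p x)) = G.edgeFinset) (x : V) :
    G.incidenceFinset x = ((Finset.univ.erase r).filter (fun y ↦ y = x ∨ p y = x)).image
      (fun y ↦ s(y, p y)) := by
  ext e
  rw [mem_incidenceFinset, incidenceSet, Set.mem_ofPred_eq, ← mem_edgeFinset, ← himage]
  simp only [Finset.mem_image, Finset.mem_filter]
  constructor
  · rintro ⟨⟨y, hy, rfl⟩, hx⟩
    exact ⟨y, ⟨hy, by rcases Sym2.mem_iff.mp hx with h | h <;> simp [h]⟩, rfl⟩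
  · rintro ⟨y, ⟨hy, hx⟩, rfl⟩
    exact ⟨⟨y, hy, rfl⟩, by rcases hx with rfl | rfl <;> simp⟩

/-- The sum of the edge labels at a vertex, if the label of an edge is stored at its lower end. -/
theorem sum_incidenceFinset_eq_sum_parent {r : V} {p : V → V}
    (hadj : ∀ x, x ≠ r → G.Adj x (p x))
    (hinj : Set.InjOn (fun x ↦ s(x, p x)) {r}ᶜ)
    (himage : (Finset.univ.erase r).image (fun x ↦ s(x, p x)) = G.edgeFinset)
    {φ : Sym2 V → ℕ} {f : V → ℕ} (hφ : ∀ x, x ≠ r → φ s(x, p x) = f x) (hf : f r = 0) (x : V) :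
    ∑ e ∈ G.incidenceFinset x, φ e = f x + ∑ y ∈ (Finset.univ.erase r).filter (p · = x), f y := by
  rw [incidenceFinset_eq_image_parent himage,
    Finset.sum_image (hinj.mono fun y hy ↦ by simp at hy; simpa using hy.1),
    Finset.filter_or, Finset.sum_union]
  · congr 1
    · by_cases hx : x = r
      · rw [Finset.filter_eq', if_neg (by simp [hx]), Finset.sum_empty, hx, hf]
      · rw [Finset.filter_eq', if_pos (by simp [hx]), Finset.sum_singleton, hφ x hx]
    · exact Finset.sum_congr rfl fun y hy ↦ hφ y (by simp at hy; exact hy.1)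
  · rw [Finset.disjoint_left]
    intro y hy hy'
    simp only [Finset.mem_filter, Finset.mem_erase] at hy hy'
    exact (hadj y hy.1.1).ne (hy.2.trans hy'.2.symm)

/-- The degree of a vertex of a rooted tree in terms of its children. -/
theorem degree_eq_card_children {r : V} {p : V → V}
    (hadj : ∀ x, x ≠ r → G.Adj x (p x))
    (hinj : Set.InjOn (fun x ↦ s(x, p x)) {r}ᶜ)
    (himage : (Finset.univ.erase r).image (fun x ↦ s(x, p x)) = G.edgeFinset) (x : V) :
    G.degree x = (if x = r then 0 else 1) + ((Finset.univ.erase r).filter (p · = x)).card := by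
  have := sum_incidenceFinset_eq_sum_parent (φ := fun _ ↦ 1) (f := fun x ↦ if x = r then 0 else 1)
    hadj hinj himage (fun x hx ↦ by simp [hx]) (by simp) x
  rw [← Finset.card_eq_sum_ones, card_incidenceFinset_eq_degree] at this
  rw [this, Finset.card_eq_sum_ones]
  congr 1
  exact Finset.sum_congr rfl fun y hy ↦ if_neg (by simp at hy; exact hy.1)

/-- A walk without backtracking that starts at the root descends the tree. -/
theorem parent_of_chain {r : V} {p : V → V} (hp : p r = r)
    (hdist : ∀ x, x ≠ r → G.Adj x (p x) ∧ G.dist r x = G.dist r (p x) + 1)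
    (himage : (Finset.univ.erase r).image (fun x ↦ s(x, p x)) = G.edgeFinset)
    {N : ℕ} {v : ℕ → V} (hv : v 0 = r) (hadj : ∀ i < N, G.Adj (v i) (v (i + 1)))
    (hne : ∀ i, i + 2 ≤ N → v (i + 2) ≠ v i) {i : ℕ} (hi : i ≤ N) :
    G.dist r (v i) = i ∧ ∀ j, i = j + 1 → p (v i) = v j := by
  induction i with
  | zero => simp [hv]
  | succ i ih =>
    obtain ⟨h₁, h₂⟩ := ih (by omega)
    have h := hadj i (by omega)
    have h₃ : p (v (i + 1)) = v i := by
      have he : s(v i, v (i + 1)) ∈ G.edgeFinset := by simpa using h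
      rw [← himage] at he
      obtain ⟨y, hy, he⟩ := Finset.mem_image.mp he
      rcases Sym2.eq_iff.mp he with ⟨rfl, h₄⟩ | ⟨rfl, h₄⟩
      · cases i with
        | zero => exact absurd hv (Finset.ne_of_mem_erase hy)
        | succ i => exact absurd ((h₂ i rfl).symm.trans h₄).symm (hne i (by omega))
      · exact h₄
    have h₄ : v (i + 1) ≠ r := by
      intro h₅
      rw [h₅, hp] at h₃
      exact h.ne (h₃.symm.trans h₅.symm)
    refine ⟨by rw [(hdist _ h₄).2, h₃, h₁], ?_⟩
    rintro j hj
    obtain rfl : i = j := by omega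
    exact h₃

/-! ### Labeling off the path, modulo `M` -/

/-- Suppose the vertices of even degree of a tree are the interior vertices of a path
`v 0, …, v N`. Then the edges outside of the path can be labeled by an interval in such a way that
all vertex sums are controlled modulo `M`. -/
theorem IsTree.exists_edge_labeling (hG : G.IsTree) {N : ℕ} (hN : 0 < N) {v : ℕ → V}
    (hadj : ∀ i < N, G.Adj (v i) (v (i + 1))) (hne : ∀ i, i + 2 ≤ N → v (i + 2) ≠ v i)
    (heven : ∀ x, Even (G.degree x) ↔ ∃ i, 0 < i ∧ i < N ∧ v i = x) :
    ∃ t, G.edgeFinset.card = N + 2 * t ∧ ∀ (s M : ℕ) (e : ℕ → ℕ), s ≤ N →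
      M = 2 * s + 2 * t + 1 → e 0 = 0 → e (N + 1) = 0 → Set.InjOn e (Set.Icc 1 N) →
      (∀ i, 1 ≤ i → i ≤ N → 1 ≤ e i ∧ e i ≤ N + 2 * t ∧ (e i ≤ s ∨ M ≤ e i + s)) →
      ∃ (φ : Sym2 V → ℕ) (f : V → ℕ), Set.BijOn φ G.edgeSet (Set.Icc 1 G.edgeFinset.card) ∧
        Set.InjOn f (v '' Set.Iic N)ᶜ ∧
        (∀ x, x ∉ v '' Set.Iic N → s + 1 ≤ f x ∧ f x ≤ s + 2 * t ∧
          ∃ c, G.vertexSum φ x = f x + M * c) ∧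
        ∀ i ≤ N, G.vertexSum φ (v i) = e i + e (i + 1) + M * ((G.degree (v i) - 1) / 2) := by
  obtain ⟨p, hp, hdist, hinj, himage⟩ := hG.exists_parent (v 0)
  have hpadj := fun x hx ↦ (hdist x hx).1
  have hchain := fun i (hi : i ≤ N) ↦ parent_of_chain hp hdist himage rfl hadj hne hi
  have hv : Set.InjOn v (Set.Iic N) := by
    intro i hi j hj h
    have h₁ := (hchain i hi).1
    rw [h, (hchain j hj).1] at h₁
    exact h₁.symm
  have hv0 : ∀ i, i ≤ N → (v i = v 0 ↔ i = 0) := fun i hi ↦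
    ⟨fun h ↦ hv hi (Nat.zero_le N) h, fun h ↦ by rw [h]⟩
  set P := (Finset.range (N + 1)).image v with hP
  have hmemP : ∀ x, x ∈ P ↔ x ∈ v '' Set.Iic N := by
    intro x
    simp [hP]
  have hcardP : P.card = N + 1 := by
    rw [hP, Finset.card_image_of_injOn, Finset.card_range]
    exact hv.mono fun i hi ↦ by simpa [Nat.lt_succ_iff] using hi
  set O := Pᶜ with hO
  have hcover : ∀ x, x ∈ O ∨ ∃ i ≤ N, v i = x := by
    intro x
    by_cases hx : x ∈ P
    · exact Or.inr ((hmemP x).mp hx)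
    · exact Or.inl (by simpa [hO] using hx)
  have hOne : ∀ x ∈ O, ∀ i ≤ N, v i ≠ x := by
    rintro x hx i hi rfl
    exact (Finset.mem_compl.mp hx) ((hmemP _).mpr ⟨i, hi, rfl⟩)
  -- the children of `x` are those outside of the path and possibly one on the path
  have hsplit : ∀ x, (Finset.univ.erase (v 0)).filter (p · = x) =
      O.filter (p · = x) ∪ (P.erase (v 0)).filter (p · = x) := by
    intro x
    have h0 : v 0 ∈ P := (hmemP _).mpr ⟨0, by simp, rfl⟩
    ext y
    simp only [hO, Finset.mem_filter, Finset.mem_erase, Finset.mem_union, Finset.mem_compl,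
      Finset.mem_univ, and_true]
    constructor
    · rintro ⟨h₁, h₂⟩
      tauto
    · rintro (⟨h₁, h₂⟩ | ⟨h₁, h₂⟩)
      · exact ⟨fun h ↦ h₁ (h ▸ h0), h₂⟩
      · exact ⟨h₁.1, h₂⟩
  have hdisj : ∀ x, Disjoint (O.filter (p · = x)) ((P.erase (v 0)).filter (p · = x)) := by
    intro x
    rw [Finset.disjoint_left]
    intro y hy hy'
    simp only [hO, Finset.mem_filter, Finset.mem_erase, Finset.mem_compl] at hy hy'
    exact hy.1 hy'.1.2
  have hpathO : ∀ x ∈ O, (P.erase (v 0)).filter (p · = x) = ∅ := by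
    intro x hx
    rw [Finset.filter_eq_empty_iff]
    intro y hy h
    obtain ⟨hy0, hy⟩ := Finset.mem_erase.mp hy
    obtain ⟨i, hi, rfl⟩ := (hmemP y).mp hy
    simp only [Set.mem_Iic] at hi
    obtain ⟨j, rfl⟩ : ∃ j, i = j + 1 := Nat.exists_eq_succ_of_ne_zero (fun h ↦ hy0 (by rw [h]))
    exact hOne x hx j (by omega) (((hchain _ hi).2 j rfl).symm.trans h)
  have hpathP : ∀ i ≤ N, (P.erase (v 0)).filter (p · = v i) =
      if i < N then {v (i + 1)} else ∅ := by
    intro i hi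
    have key : ∀ y, y ∈ (P.erase (v 0)).filter (p · = v i) ↔ i < N ∧ y = v (i + 1) := by
      intro y
      rw [Finset.mem_filter, Finset.mem_erase, hmemP]
      constructor
      · rintro ⟨⟨hy0, j, hj, rfl⟩, hpj⟩
        simp only [Set.mem_Iic] at hj
        obtain ⟨l, rfl⟩ : ∃ l, j = l + 1 :=
          Nat.exists_eq_succ_of_ne_zero (fun h ↦ hy0 (by rw [h]))
        rw [(hchain _ hj).2 l rfl] at hpj
        obtain rfl : l = i := hv (show l ≤ N by omega) hi hpj
        exact ⟨by omega, rfl⟩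
      · rintro ⟨h, rfl⟩
        refine ⟨⟨fun h' ↦ ?_, i + 1, h, rfl⟩, (hchain _ h).2 i rfl⟩
        have := (hv0 (i + 1) h).mp h'
        omega
    ext y
    rw [key]
    split_ifs with h <;> simp [h]
  have hdegO : ∀ x ∈ O, G.degree x = 1 + (O.filter (p · = x)).card := by
    intro x hx
    rw [degree_eq_card_children hpadj hinj himage, if_neg (hOne x hx 0 (by omega)).symm, hsplit,
      hpathO x hx, Finset.union_empty]
  have hdegP : ∀ i ≤ N, G.degree (v i) =
      (if i = 0 then 0 else 1) + (if i < N then 1 else 0) + (O.filter (p · = v i)).card := by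
    intro i hi
    rw [degree_eq_card_children hpadj hinj himage, hsplit, Finset.card_union_of_disjoint (hdisj _),
      hpathP i hi]
    simp only [hv0 i hi]
    split_ifs <;> simp <;> omega
  -- Parent and path edges account for one edge at an off-path vertex or an end of the path (odd
  -- degree), and for two at an interior path vertex (even degree).
  have hfib : ∀ x, Even (O.filter (p · = x)).card := by
    intro x
    have h₁ := heven x
    rcases hcover x with hx | ⟨i, hi, rfl⟩
    · have h₂ : ¬ Even (G.degree x) := by
        rw [h₁]
        rintro ⟨i, _, hi, h⟩
        exact hOne x hx i hi.le h
      rw [hdegO x hx, Nat.even_add] at h₂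
      simpa using h₂
    · have h₂ : (∃ j, 0 < j ∧ j < N ∧ v j = v i) ↔ 0 < i ∧ i < N := by
        constructor
        · rintro ⟨j, hj, hj', h⟩
          obtain rfl := hv hj'.le hi h
          exact ⟨hj, hj'⟩
        · exact fun h ↦ ⟨i, h.1, h.2, rfl⟩
      rw [h₂, hdegP i hi] at h₁
      rw [Nat.even_iff] at h₁ ⊢
      split_ifs at h₁ <;> omega
  obtain ⟨t, ht⟩ : ∃ t, O.card = 2 * t := by
    have : Even O.card := by
      rw [Finset.card_eq_sum_card_fiberwise (f := p) (t := Finset.univ) (by simp)]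
      exact Finset.even_sum _ fun x _ ↦ hfib x
    exact this.exists_two_nsmul _ |>.imp fun t h ↦ by simpa using h
  have hcard : G.edgeFinset.card = N + 2 * t := by
    have h₁ := hG.card_edgeFinset
    have h₂ := Finset.card_add_card_compl P
    rw [hcardP, ← hO, ht] at h₂
    omega
  refine ⟨t, hcard, ?_⟩
  intro s M e hs hM he0 heN heinj herange
  obtain ⟨g, hginj, hgrange, hgsum⟩ := exists_labeling_of_even_fibers p t O s ht hfib
  have := hG.connected.nonempty
  -- `f x` is the label of the edge from `x` to its parent, so `e i` labels the edge from `v (i -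
  -- 1)` to `v i`; the root gets the dummy value `e 0 = 0`.
  have hfex : ∃ f : V → ℕ, (∀ x ∈ O, f x = g x) ∧ ∀ i ≤ N, f (v i) = e i := by
    classical
    refine ⟨fun x ↦ if h : ∃ i ≤ N, v i = x then e h.choose else g x, ?_, ?_⟩
    · intro x hx
      refine dif_neg ?_
      rintro ⟨i, hi, h⟩
      exact hOne x hx i hi h
    · intro i hi
      have h : ∃ j ≤ N, v j = v i := ⟨i, hi, rfl⟩
      simp only [dif_pos h]
      rw [hv h.choose_spec.1 hi h.choose_spec.2]
  obtain ⟨f, hfO, hfP⟩ := hfex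
  have hφex : ∃ φ : Sym2 V → ℕ, ∀ x, x ≠ v 0 → φ s(x, p x) = f x := by
    refine ⟨fun e ↦ f (Function.invFunOn (fun x ↦ s(x, p x)) {v 0}ᶜ e), fun x hx ↦ ?_⟩
    exact congrArg f (hinj.leftInvOn_invFunOn hx)
  obtain ⟨φ, hφ⟩ := hφex
  have hsum : ∀ x, G.vertexSum φ x = f x + ∑ y ∈ (P.erase (v 0)).filter (p · = x), f y +
      M * ((O.filter (p · = x)).card / 2) := by
    intro x
    rw [vertexSum, sum_incidenceFinset_eq_sum_parent hpadj hinj himage hφ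
      (by rw [hfP 0 (by omega), he0]), hsplit, Finset.sum_union (hdisj x),
      Finset.sum_congr rfl fun y hy ↦ hfO y (Finset.mem_of_mem_filter y hy), hgsum, hM]
    ring
  have hfinj : Set.InjOn f {v 0}ᶜ := by
    intro x hx y hy h
    rcases hcover x with hxO | ⟨i, hi, rfl⟩ <;> rcases hcover y with hyO | ⟨j, hj, rfl⟩
    · rw [hfO x hxO, hfO y hyO] at h
      exact hginj hxO hyO h
    · exfalso
      have h₁ := hgrange x hxO
      have h₂ := herange j (Nat.one_le_iff_ne_zero.mpr fun h ↦ hy (by simp [h])) hj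
      rw [hfO x hxO, hfP j hj] at h
      omega
    · exfalso
      have h₁ := hgrange y hyO
      have h₂ := herange i (Nat.one_le_iff_ne_zero.mpr fun h ↦ hx (by simp [h])) hi
      rw [hfO y hyO, hfP i hi] at h
      omega
    · rw [hfP i hi, hfP j hj] at h
      rw [heinj ⟨Nat.one_le_iff_ne_zero.mpr fun h ↦ hx (by simp [h]), hi⟩
        ⟨Nat.one_le_iff_ne_zero.mpr fun h ↦ hy (by simp [h]), hj⟩ h]
  have hφmaps : Set.MapsTo φ G.edgeSet (Set.Icc 1 G.edgeFinset.card) := by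
    intro e' he'
    rw [← mem_edgeFinset, ← himage] at he'
    obtain ⟨x, hx, rfl⟩ := Finset.mem_image.mp he'
    have hx := Finset.ne_of_mem_erase hx
    rw [hφ x hx, hcard, Set.mem_Icc]
    rcases hcover x with hxO | ⟨i, hi, rfl⟩
    · have h₁ := hgrange x hxO
      rw [hfO x hxO]
      omega
    · have h₂ := herange i (Nat.one_le_iff_ne_zero.mpr fun h ↦ hx (by simp [h])) hi
      rw [hfP i hi]
      omega
  have hφinj : Set.InjOn φ G.edgeSet := by
    intro e₁ he₁ e₂ he₂ h
    rw [← mem_edgeFinset, ← himage] at he₁ he₂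
    obtain ⟨x, hx, rfl⟩ := Finset.mem_image.mp he₁
    obtain ⟨y, hy, rfl⟩ := Finset.mem_image.mp he₂
    have hx := Finset.ne_of_mem_erase hx
    have hy := Finset.ne_of_mem_erase hy
    rw [hφ x hx, hφ y hy] at h
    rw [hfinj hx hy h]
  refine ⟨φ, f, ⟨hφmaps, hφinj, ?_⟩, ?_, ?_, ?_⟩
  · have := Finset.surjOn_of_injOn_of_card_le (s := G.edgeFinset)
      (t := Finset.Icc 1 G.edgeFinset.card) φ (by simpa using hφmaps) (by simpa using hφinj)
      (by simp)
    simpa using this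
  · exact hfinj.mono (Set.compl_subset_compl.mpr (by simpa using ⟨0, by simp, rfl⟩))
  · intro x hx
    have hxO : x ∈ O := by rwa [hO, Finset.mem_compl, hmemP]
    have h := hgrange x hxO
    rw [hsum x, hpathO x hxO, Finset.sum_empty, hfO x hxO]
    exact ⟨h.1, h.2, _, rfl⟩
  · intro i hi
    -- The floor absorbs the difference between ends (degree `1 + 2c`) and interior vertices (degree
    -- `2 + 2c`).
    have h₁ : (O.filter (p · = v i)).card / 2 = (G.degree (v i) - 1) / 2 := by
      have h₂ := hdegP i hi
      obtain ⟨c, hc⟩ := hfib (v i)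
      split_ifs at h₂ <;> omega
    rw [hsum, h₁, hfP i hi, hpathP i hi]
    congr 2
    split_ifs with h
    · rw [Finset.sum_singleton, hfP _ h]
    · obtain rfl : i = N := by omega
      rw [Finset.sum_empty, heN]

/-! ### The two cases of the theorem -/

/-- A tree is antimagic if its vertices of even degree are the interior vertices of a path of odd
length at least three. -/
theorem IsTree.isAntimagic_of_even_degree_on_path (hG : G.IsTree) {k : ℕ} (hk : 0 < k) {v : ℕ → V}
    (hadj : ∀ i < 2 * k + 1, G.Adj (v i) (v (i + 1)))
    (hne : ∀ i, i + 2 ≤ 2 * k + 1 → v (i + 2) ≠ v i)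
    (heven : ∀ x, Even (G.degree x) ↔ ∃ i, 0 < i ∧ i < 2 * k + 1 ∧ v i = x) :
    G.IsAntimagic := by
  obtain ⟨t, -, h⟩ := hG.exists_edge_labeling (by omega) hadj hne heven
  obtain ⟨s, ε, hks, hs, hε0, hεN, hεinj, hεrange, hσinj, hσrange⟩ :=
    exists_signed_path_labeling hk
  obtain ⟨M, hM⟩ : ∃ M, M = 2 * s + 2 * t + 1 := ⟨_, rfl⟩
  -- Negative values are shifted by `M`: `[-s, 2k-2s]` becomes `[s+2t+1, 2k+1+2t]`, exactly the
  -- labels above those used off the path.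
  let e : ℕ → ℕ := fun i ↦ if 0 ≤ ε i then (ε i).toNat else (M + ε i).toNat
  have he : ∀ i, i ≤ 2 * k + 2 → (0 ≤ ε i ∧ (e i : ℤ) = ε i) ∨ (ε i < 0 ∧ (e i : ℤ) = M + ε i) := by
    intro i hi
    have h₁ : -(s : ℤ) ≤ ε i := by
      rcases Nat.eq_zero_or_pos i with rfl | h₁
      · omega
      rcases Nat.lt_or_ge (2 * k + 1) i with h₂ | h₂
      · obtain rfl : i = 2 * k + 2 := by omega
        omega
      · have := hεrange i h₁ h₂
        omega
    simp only [e]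
    split_ifs <;> omega
  obtain ⟨φ, f, hbij, hfinj, hf, hv⟩ := h s M e (by omega) hM
    (by have := he 0 (by omega); omega) (by have := he (2 * k + 2) le_rfl; change e (2 * k + 2) = 0; omega)
    (by
      rintro i ⟨hi, hi'⟩ j ⟨hj, hj'⟩ hij
      refine hεinj ⟨hi, hi'⟩ ⟨hj, hj'⟩ ?_
      have h₁ := he i (by omega)
      have h₂ := he j (by omega)
      have h₃ := hεrange i hi hi'
      have h₄ := hεrange j hj hj'
      omega)
    (by
      intro i hi hi'
      have h₁ := he i (by omega)
      have h₃ := hεrange i hi hi'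
      omega)
  -- every vertex sum is congruent modulo `M` to a residue that determines the vertex
  have hres : ∀ x, ∃ a b : ℤ, (G.vertexSum φ x : ℤ) = a + M * b ∧
      ((∃ i ≤ 2 * k + 1, v i = x ∧ a = ε i + ε (i + 1)) ∨
        (x ∉ v '' Set.Iic (2 * k + 1) ∧ a = f x)) := by
    intro x
    by_cases hx : x ∈ v '' Set.Iic (2 * k + 1)
    · obtain ⟨i, hi, rfl⟩ := hx
      have hi : i ≤ 2 * k + 1 := hi
      have h₁ : ∀ j ≤ 2 * k + 2, ∃ b : ℤ, (e j : ℤ) = ε j + M * b := fun j hj ↦ by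
        rcases he j hj with h | h
        · exact ⟨0, by rw [h.2]; ring⟩
        · exact ⟨1, by rw [h.2]; ring⟩
      obtain ⟨b, hb⟩ := h₁ i (by omega)
      obtain ⟨c, hc⟩ := h₁ (i + 1) (by omega)
      refine ⟨ε i + ε (i + 1), b + c + ((G.degree (v i) - 1) / 2 : ℕ), ?_,
        Or.inl ⟨i, hi, rfl, rfl⟩⟩
      rw [hv i hi]
      push_cast [hb, hc]
      ring
    · obtain ⟨-, -, c, hc⟩ := hf x hx
      exact ⟨f x, c, by rw [hc]; push_cast; ring, Or.inr ⟨hx, rfl⟩⟩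
  have hbound : ∀ {x : V} {a : ℤ}, ((∃ i ≤ 2 * k + 1, v i = x ∧ a = ε i + ε (i + 1)) ∨
      (x ∉ v '' Set.Iic (2 * k + 1) ∧ a = f x)) → -(s : ℤ) ≤ a ∧ a ≤ s + 2 * t := by
    rintro x a (⟨i, hi, rfl, rfl⟩ | ⟨hx, rfl⟩)
    · have := hσrange i hi
      omega
    · have := hf x hx
      omega
  refine ⟨φ, hbij, fun x y hxy ↦ ?_⟩
  obtain ⟨a, b, hx, hax⟩ := hres x
  obtain ⟨a', b', hy, hay⟩ := hres y
  rw [hxy, hy] at hx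
  -- Both residues lie in `[-s, s+2t]`, which has exactly `M` elements.
  have haa : a = a' := by
    have h₁ := hbound hax
    have h₂ := hbound hay
    have h₃ : (M : ℤ) ∣ a - a' := ⟨b' - b, by linarith⟩
    have h₄ := Int.eq_zero_of_abs_lt_dvd h₃ (by rw [abs_lt]; omega)
    omega
  rcases hax with ⟨i, hi, rfl, hai⟩ | ⟨hxP, hax⟩ <;> rcases hay with ⟨j, hj, rfl, haj⟩ | ⟨hyP, hay⟩
  · rw [hσinj hi hj (hai.symm.trans (haa.trans haj))]
  · have h₁ := hσrange i hi
    have h₂ := hf y hyP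
    omega
  · have h₁ := hσrange j hj
    have h₂ := hf x hxP
    omega
  · exact hfinj hxP hyP (by omega)

/-- A tree other than `K₂` without vertices of even degree is antimagic. -/
theorem IsTree.isAntimagic_of_odd_degree (hG : G.IsTree) (hodd : ∀ x, Odd (G.degree x))
    (hK2 : ¬ Nonempty (G ≃g (⊤ : SimpleGraph (Fin 2)))) : G.IsAntimagic := by
  have hnt : Nontrivial V := by
    obtain ⟨x⟩ := hG.connected.nonempty
    obtain ⟨y, hy⟩ := (G.degree_pos_iff_exists_adj x).mp (hodd x).pos
    exact ⟨x, y, hy.ne⟩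
  obtain ⟨a, ha⟩ := hG.exists_vert_degree_one_of_nontrivial
  obtain ⟨b, hab, hb⟩ := degree_eq_one_iff_existsUnique_adj.mp ha
  -- Otherwise no edge leaves `{a, b}`, and connectedness forces `K₂`.
  obtain ⟨c, hbc, hca⟩ : ∃ c, G.Adj b c ∧ c ≠ a := by
    by_contra! hcon
    have hall : ∀ x, x = a ∨ x = b := by
      intro x
      by_contra hx
      obtain ⟨w⟩ := hG.connected a x
      obtain ⟨⟨⟨y, z⟩, hyz⟩, -, hy, hz⟩ := w.exists_boundary_dart {a, b} (by simp) (by simpa using hx)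
      simp only [Set.mem_insert_iff, Set.mem_singleton_iff, not_or] at hy hz
      rcases hy with rfl | rfl
      · exact hz.2 (hb z hyz)
      · exact hz.1 (hcon z hyz)
    refine hK2 ⟨⟨⟨fun x ↦ if x = a then 0 else 1, fun i ↦ if i = 0 then a else b, ?_, ?_⟩, ?_⟩⟩
    · intro x
      rcases hall x with rfl | rfl <;> simp [hab.ne']
    · intro i
      fin_cases i <;> simp [hab.ne']
    · intro x y
      rcases hall x with rfl | rfl <;> rcases hall y with rfl | rfl <;>
        simp [hab, hab.symm, hab.ne']
  have hdeg : 3 ≤ G.degree b := by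
    have h₁ : 1 < G.degree b := by
      rw [← card_neighborFinset_eq_degree, Finset.one_lt_card]
      exact ⟨a, by simpa using hab.symm, c, by simpa using hbc, hca.symm⟩
    obtain ⟨d, hd⟩ := hodd b
    omega
  let v : ℕ → V := fun i ↦ if i = 0 then a else b
  have hv : v '' Set.Iic 1 = {a, b} := by
    ext x
    simp only [Set.mem_image, Set.mem_Iic, Set.mem_insert_iff, Set.mem_singleton_iff]
    constructor
    · rintro ⟨i, -, rfl⟩
      simp only [v]
      split_ifs <;> simp
    · rintro (rfl | rfl)
      · exact ⟨0, by simp, by simp [v]⟩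
      · exact ⟨1, le_rfl, by simp [v]⟩
  obtain ⟨t, -, h⟩ := hG.exists_edge_labeling (N := 1) (v := v) one_pos
    (by intro i hi; obtain rfl : i = 0 := by omega
        simpa [v] using hab)
    (by intro i hi; omega)
    (by
      intro x
      constructor
      · intro hx
        exact absurd hx (Nat.not_even_iff_odd.mpr (hodd x))
      · rintro ⟨i, h₁, h₂, -⟩
        omega)
  -- With `s = 0` the pendant edge `ab` gets the top label `M = 2t+1`. The sum at `a` is `M`; at `b`
  -- it is at least `2M`, since `b` has degree at least `3`.
  obtain ⟨φ, f, hbij, hfinj, hf, hsum⟩ := h 0 (2 * t + 1) (fun i ↦ if i = 1 then 2 * t + 1 else 0)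
    (by omega) (by omega) (by simp) (by simp)
    (by rintro i ⟨hi, hi'⟩ j ⟨hj, hj'⟩ -; omega)
    (by intro i hi hi'; rw [if_pos (by omega)]; omega)
  rw [hv] at hfinj hf
  have hsa : G.vertexSum φ a = 2 * t + 1 := by
    have := hsum 0 (by omega)
    simpa [v, ha] using this
  have hsb : ∃ d, G.vertexSum φ b = (2 * t + 1) * (d + 2) := by
    have := hsum 1 le_rfl
    obtain ⟨d, hd⟩ : ∃ d, (G.degree b - 1) / 2 = d + 1 := ⟨(G.degree b - 1) / 2 - 1, by omega⟩
    refine ⟨d, ?_⟩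
    rw [show v 1 = b by simp [v], hd, if_pos rfl, if_neg (by omega)] at this
    rw [this]
    ring
  obtain ⟨d, hsb⟩ := hsb
  have hmodb : G.vertexSum φ b % (2 * t + 1) = 0 := by rw [hsb, Nat.mul_mod_right]
  have hmoda : G.vertexSum φ a % (2 * t + 1) = 0 := by rw [hsa, Nat.mod_self]
  have hmod : ∀ x, x ∉ ({a, b} : Set V) → G.vertexSum φ x % (2 * t + 1) = f x ∧ 0 < f x := by
    intro x hx
    obtain ⟨h₁, h₂, c, hc⟩ := hf x hx
    rw [hc, Nat.add_mul_mod_self_left, Nat.mod_eq_of_lt (by omega)]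
    exact ⟨rfl, by omega⟩
  have hne : G.vertexSum φ a ≠ G.vertexSum φ b := by
    rw [hsa, hsb]
    nlinarith [Nat.zero_le (d * t)]
  refine ⟨φ, hbij, fun x y hxy ↦ ?_⟩
  by_cases hx : x ∈ ({a, b} : Set V) <;> by_cases hy : y ∈ ({a, b} : Set V)
  · rcases hx with rfl | rfl <;> rcases hy with rfl | rfl
    · rfl
    · exact absurd hxy hne
    · exact absurd hxy.symm hne
    · rfl
  · have h₁ := hmod y hy
    rcases hx with rfl | rfl <;> (rw [← hxy] at h₁; omega)
  · have h₁ := hmod x hx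
    rcases hy with rfl | rfl <;> (rw [hxy] at h₁; omega)
  · have h₁ := hmod x hx
    have h₂ := hmod y hy
    rw [hxy] at h₁
    exact hfinj hx hy (h₁.1.symm.trans h₂.1)

end Tree

/-! ### Extending the even path -/

/-- A path induced by the vertices of even degree can be extended at both ends. -/
theorem exists_extended_even_path {V : Type*} [Fintype V] {G : SimpleGraph V}
    [DecidableRel G.Adj] (hconn : G.Connected) {k : ℕ} (hk : 0 < k)
    (ψ : G.induce G.evenDegreeVertices ≃g pathGraph (2 * k)) :
    ∃ v : ℕ → V, (∀ i < 2 * k + 1, G.Adj (v i) (v (i + 1))) ∧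
      (∀ i, i + 2 ≤ 2 * k + 1 → v (i + 2) ≠ v i) ∧
      ∀ x, Even (G.degree x) ↔ ∃ i, 0 < i ∧ i < 2 * k + 1 ∧ v i = x := by
  have : NeZero (2 * k) := ⟨by omega⟩
  obtain ⟨u, hu⟩ : ∃ u : ℕ → V, ∀ i : Fin (2 * k), u i = ψ.symm i :=
    ⟨fun i ↦ ψ.symm (Fin.ofNat (2 * k) i), fun i ↦ by simp⟩
  have hueven : ∀ x, Even (G.degree x) ↔ ∃ i < 2 * k, u i = x := by
    intro x
    constructor
    · intro hx
      exact ⟨ψ ⟨x, hx⟩, (ψ ⟨x, hx⟩).2, by rw [hu]; simp⟩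
    · rintro ⟨i, hi, rfl⟩
      rw [hu ⟨i, hi⟩]
      exact (ψ.symm ⟨i, hi⟩).2
  have huinj : ∀ i < 2 * k, ∀ j < 2 * k, u i = u j → i = j := by
    intro i hi j hj h
    rw [hu ⟨i, hi⟩, hu ⟨j, hj⟩] at h
    simpa using ψ.symm.injective (Subtype.ext h)
  have huadj : ∀ i < 2 * k, ∀ j < 2 * k, G.Adj (u i) (u j) ↔ i + 1 = j ∨ j + 1 = i := by
    intro i hi j hj
    rw [hu ⟨i, hi⟩, hu ⟨j, hj⟩]
    have := ψ.symm.map_adj_iff (v := ⟨i, hi⟩) (w := ⟨j, hj⟩)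
    rw [pathGraph_adj] at this
    simpa using this
  -- A positive even degree is at least `2`, so a vertex with at most one even neighbor has an odd
  -- one.
  have hnbr : ∀ i < 2 * k, ∀ j < 2 * k, (∀ l < 2 * k, G.Adj (u i) (u l) → l = j) →
      ∃ y, G.Adj (u i) y ∧ ¬ Even (G.degree y) := by
    intro i hi j hj hij
    by_contra! hcon
    have h₁ : G.neighborFinset (u i) ⊆ {u j} := by
      intro y hy
      rw [mem_neighborFinset] at hy
      obtain ⟨l, hl, rfl⟩ := (hueven y).mp (hcon y hy)
      simp [hij l hl hy]
    have h₂ := Finset.card_le_card h₁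
    rw [card_neighborFinset_eq_degree, Finset.card_singleton] at h₂
    have h₃ : 0 < G.degree (u i) := by
      have : Nontrivial V := ⟨u 0, u 1, fun h ↦ by
        have := huinj 0 (by omega) 1 (by omega) h
        omega⟩
      exact hconn.preconnected.degree_pos_of_nontrivial _
    obtain ⟨c, hc⟩ := (hueven (u i)).mpr ⟨i, hi, rfl⟩
    omega
  obtain ⟨a, ha, ha'⟩ := hnbr 0 (by omega) 1 (by omega) fun l hl h ↦ by
    rw [huadj 0 (by omega) l hl] at h
    omega
  obtain ⟨b, hb, hb'⟩ := hnbr (2 * k - 1) (by omega) (2 * k - 2) (by omega) fun l hl h ↦ by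
    rw [huadj _ (by omega) l hl] at h
    omega
  rw [hueven] at ha' hb'
  push Not at ha' hb'
  -- Nothing here excludes `a = b`; only the absence of backtracking is needed, which in a tree
  -- makes the `v i` distinct by `parent_of_chain`.
  let v : ℕ → V := fun i ↦ if i = 0 then a else if i ≤ 2 * k then u (i - 1) else b
  have hvu : ∀ i < 2 * k, v (i + 1) = u i := by
    intro i hi
    simp only [v]
    rw [if_neg (by omega), if_pos (by omega), Nat.add_sub_cancel]
  have hv0 : v 0 = a := by simp [v]
  have hvb : v (2 * k + 1) = b := by simp [v]
  refine ⟨v, ?_, ?_, ?_⟩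
  · intro i hi
    rcases Nat.eq_zero_or_pos i with rfl | h₁
    · rw [hv0, hvu 0 (by omega)]
      exact ha.symm
    obtain ⟨j, rfl⟩ : ∃ j, i = j + 1 := ⟨i - 1, by omega⟩
    rw [hvu j (by omega)]
    rcases Nat.lt_or_ge (j + 1) (2 * k) with h₂ | h₂
    · rw [hvu _ h₂, huadj j (by omega) _ h₂]
      exact Or.inl rfl
    · obtain rfl : j = 2 * k - 1 := by omega
      rwa [show 2 * k - 1 + 1 + 1 = 2 * k + 1 by omega, hvb]
  · intro i hi
    rcases Nat.eq_zero_or_pos i with rfl | h₁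
    · rw [hv0, hvu 1 (by omega)]
      exact ha' 1 (by omega)
    obtain ⟨j, rfl⟩ : ∃ j, i = j + 1 := ⟨i - 1, by omega⟩
    rw [hvu j (by omega)]
    rcases Nat.lt_or_ge (j + 2) (2 * k) with h₂ | h₂
    · rw [show j + 1 + 2 = j + 2 + 1 by ring, hvu _ h₂]
      intro h
      have := huinj _ h₂ _ (by omega) h
      omega
    · rw [show j + 1 + 2 = 2 * k + 1 by omega, hvb]
      exact (hb' j (by omega)).symm
  · intro x
    rw [hueven]
    constructor
    · rintro ⟨i, hi, rfl⟩
      exact ⟨i + 1, by omega, by omega, hvu i hi⟩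
    · rintro ⟨i, h₁, h₂, rfl⟩
      exact ⟨i - 1, by omega, by rw [← hvu (i - 1) (by omega), Nat.sub_add_cancel h₁]⟩

end SimpleGraph

theorem theorem3 {V : Type*} [Fintype V] [DecidableEq V]
    (T : SimpleGraph V) [DecidableRel T.Adj]
    (hT : T.IsTree)
    (hK2 : ¬ Nonempty (T ≃g (⊤ : SimpleGraph (Fin 2))))
    (hpath : T.InducesPath T.evenDegreeVertices)
    (heven : Even T.evenDegreeVertices.ncard) :
    T.IsAntimagic := by
  obtain ⟨n, ⟨ψ⟩⟩ := hpath
  have hn : T.evenDegreeVertices.ncard = n := by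
    rw [← Nat.card_coe_set_eq, Nat.card_congr ψ.toEquiv, Nat.card_fin]
  obtain ⟨k, rfl⟩ : ∃ k, n = 2 * k := by
    rw [hn] at heven
    exact heven.exists_two_nsmul _ |>.imp fun k h ↦ by simpa using h
  rcases Nat.eq_zero_or_pos k with rfl | hk
  · refine hT.isAntimagic_of_odd_degree (fun x ↦ ?_) hK2
    rw [← Nat.not_even_iff_odd]
    exact fun hx ↦ (ψ ⟨x, hx⟩).elim0
  · obtain ⟨v, h₁, h₂, h₃⟩ := SimpleGraph.exists_extended_even_path hT.connected hk ψ
    exact hT.isAntimagic_of_even_degree_on_path hk h₁ h₂ h₃
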